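/- Let $A,B,C,D$ be finite-dimensional quantum systems and let $\rho=\rho_{ABCD}$ be a density matrix (a positive semidefinite matrix of trace one, not necessarily invertible) on $A\otimes B\otimes C\otimes D$; $\rho_R$ denotes its reduced density matrix on a subsystem $R$. For disjoint subsystems $R,S$ and $\lambda\in\mathbb R$ let $$\mathcal P^{(\lambda)}_{R\to RS}(X)=\rho_{RS}^{\frac12-\frac{i\lambda}2}\Big(\big(\rho_R^{-\frac12+\frac{i\lambda}2}\,X\,\rho_R^{-\frac12-\frac{i\lambda}2}\big)\otimes \mathbf 1_S\Big)\rho_{RS}^{\frac12+\frac{i\lambda}2}$$ be the twirled Petz map, where powers are taken on the support (and are zero on the kernel), and where the map acts as the identity on every other system. Put $$\tilde\rho^{(3),\lambda}_{ABCD}=\mathcal P^{(\lambda)}_{C\to CD}\big(\mathcal P^{(\lambda)}_{B\to AB}(\rho_{BC})\big),$$ and let $F(\rho,\sigma)=\|\sqrt\rho\sqrt\sigma\|_1$ with $\|X\|_1=\operatorname{Tr}[(X^\dagger X)^{1/2}]$, $S(R)=-\operatorname{Tr}[\rho_R\log\rho_R]$, and $I(P:Q|R)=S(PR)+S(QR)-S(R)-S(PQR)$.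 Then $$\max_{\lambda\in\mathbb R}F\big(\rho_{ABCD},\tilde\rho^{(3),\lambda}_{ABCD}\big)\ \ge\ \exp\Big(-\tfrac12\big[I(A:C|B)+I(B:D|C)+I(A:D|BC)\big]\Big),$$ in the sense that there is a real number $\lambda$ for which $F\big(\rho_{ABCD},\tilde\rho^{(3),\lambda}_{ABCD}\big)$ is at least the right-hand side. -/

import Mathlib

open scoped ComplexOrder MatrixOrder Kronecker

namespace QRecovery

/-- A quantum state (density matrix) on a system whose Hilbert space is `ℂ^n`. -/
def IsState {n : Type*} [Fintype n] (ρ : Matrix n n ℂ) : Prop :=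
  ρ.PosSemidef ∧ ρ.trace = 1

/-- The trace norm `‖X‖₁ = Tr[(X† X)^{1/2}]`. -/
noncomputable def traceNorm {n : Type*} [Fintype n] [DecidableEq n] (X : Matrix n n ℂ) : ℝ :=
  (CFC.sqrt (X.conjTranspose * X)).trace.re

/-- The fidelity `F(ρ, σ) = ‖√ρ √σ‖₁`. -/
noncomputable def fidelity {n : Type*} [Fintype n] [DecidableEq n] (ρ σ : Matrix n n ℂ) : ℝ :=
  traceNorm (CFC.sqrt ρ * CFC.sqrt σ)

/-- The von Neumann entropy `S(ρ) = -Tr[ρ log ρ]` (natural logarithm, `0 log 0 = 0`). -/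
noncomputable def entropy {n : Type*} [Fintype n] [DecidableEq n] (ρ : Matrix n n ℂ) : ℝ :=
  (cfc Real.negMulLog ρ).trace.re

/-- The complex power `A^z` of a positive semidefinite matrix, taken on the support of `A`: in an
orthonormal eigenbasis each eigenvalue `p > 0` is replaced by `p^z = exp (z log p)`, and the
kernel of `A` is sent to zero. (The value for matrices that are not Hermitian is irrelevant.) -/
noncomputable def supportPow {n : Type*} [Fintype n] [DecidableEq n]
    (A : Matrix n n ℂ) (z : ℂ) : Matrix n n ℂ :=
  open Classical in
  if h : A.IsHermitian then
    (h.eigenvectorUnitary : Matrix n n ℂ) *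
      Matrix.diagonal (fun i => if h.eigenvalues i = 0 then 0 else ((h.eigenvalues i : ℝ) : ℂ) ^ z) *
      (h.eigenvectorUnitary : Matrix n n ℂ).conjTranspose
  else 0

/-- Partial trace over the left tensor factor. -/
def traceLeft {m n : Type*} [Fintype m] (X : Matrix (m × n) (m × n) ℂ) : Matrix n n ℂ :=
  Matrix.of fun j j' => ∑ i, X (i, j) (i, j')

/-- Partial trace over the right tensor factor. -/
def traceRight {m n : Type*} [Fintype n] (X : Matrix (m × n) (m × n) ℂ) : Matrix m m ℂ :=
  Matrix.of fun i i' => ∑ j, X (i, j) (i', j)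

/-- `Φ ⊗ id`: the linear map `Φ` acts on the left tensor factor, and trivially on the right one. -/
def onLeft {m m' k : Type*} (Φ : Matrix m m ℂ →ₗ[ℂ] Matrix m' m' ℂ)
    (X : Matrix (m × k) (m × k) ℂ) : Matrix (m' × k) (m' × k) ℂ :=
  Matrix.of fun p q => Φ (Matrix.of fun i j => X (i, p.2) (j, q.2)) p.1 q.1

/-- `id ⊗ Φ`: the linear map `Φ` acts on the right tensor factor, and trivially on the left one. -/
def onRight {m m' k : Type*} (Φ : Matrix m m ℂ →ₗ[ℂ] Matrix m' m' ℂ)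
    (X : Matrix (k × m) (k × m) ℂ) : Matrix (k × m') (k × m') ℂ :=
  Matrix.of fun p q => Φ (Matrix.of fun i j => X (p.1, i) (q.1, j)) p.2 q.2

/-- The twirled Petz map `P_{R → RS}` with parameter `t` of a state `ω` on `R ⊗ S`:
`X ↦ ω_{RS}^{1/2 - it/2} ((ω_R^{-1/2 + it/2} X ω_R^{-1/2 - it/2}) ⊗ 1_S) ω_{RS}^{1/2 + it/2}`. -/
noncomputable def petzRight {r s : Type*} [Fintype r] [DecidableEq r] [Fintype s] [DecidableEq s]
    (ω : Matrix (r × s) (r × s) ℂ) (t : ℝ) :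
    Matrix r r ℂ →ₗ[ℂ] Matrix (r × s) (r × s) ℂ where
  toFun X :=
    supportPow ω (1 / 2 - Complex.I * t / 2) *
      ((supportPow (traceRight ω) (-1 / 2 + Complex.I * t / 2) * X *
        supportPow (traceRight ω) (-1 / 2 - Complex.I * t / 2)) ⊗ₖ (1 : Matrix s s ℂ)) *
      supportPow ω (1 / 2 + Complex.I * t / 2)
  map_add' X Y := by
    simp only [Matrix.mul_add, Matrix.add_mul, Matrix.add_kronecker]
  map_smul' c X := by
    simp only [Matrix.mul_smul, Matrix.smul_mul, Matrix.smul_kronecker, RingHom.id_apply]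

/-- The twirled Petz map `P_{R → SR}` with parameter `t` of a state `ω` on `S ⊗ R`; the same as
`petzRight`, except that the new system is written as the left tensor factor. -/
noncomputable def petzLeft {r s : Type*} [Fintype r] [DecidableEq r] [Fintype s] [DecidableEq s]
    (ω : Matrix (s × r) (s × r) ℂ) (t : ℝ) :
    Matrix r r ℂ →ₗ[ℂ] Matrix (s × r) (s × r) ℂ where
  toFun X :=
    supportPow ω (1 / 2 - Complex.I * t / 2) *
      ((1 : Matrix s s ℂ) ⊗ₖ (supportPow (traceLeft ω) (-1 / 2 + Complex.I * t / 2) * X *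
        supportPow (traceLeft ω) (-1 / 2 - Complex.I * t / 2))) *
      supportPow ω (1 / 2 + Complex.I * t / 2)
  map_add' X Y := by
    simp only [Matrix.mul_add, Matrix.add_mul, Matrix.kronecker_add]
  map_smul' c X := by
    simp only [Matrix.mul_smul, Matrix.smul_mul, Matrix.kronecker_smul, RingHom.id_apply]

section FourSystems

variable {a b c d : Type*} [Fintype a] [DecidableEq a] [Fintype b] [DecidableEq b]
  [Fintype c] [DecidableEq c] [Fintype d] [DecidableEq d]

/-- The reduced density matrix `ρ_AB`. -/
def margAB (ρ : Matrix ((a × b) × (c × d)) ((a × b) × (c × d)) ℂ) : Matrix (a × b) (a × b) ℂ :=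
  traceRight ρ

/-- The reduced density matrix `ρ_CD`. -/
def margCD (ρ : Matrix ((a × b) × (c × d)) ((a × b) × (c × d)) ℂ) : Matrix (c × d) (c × d) ℂ :=
  traceLeft ρ

/-- The reduced density matrix `ρ_B`. -/
def margB (ρ : Matrix ((a × b) × (c × d)) ((a × b) × (c × d)) ℂ) : Matrix b b ℂ :=
  traceLeft (margAB ρ)

/-- The reduced density matrix `ρ_C`. -/
def margC (ρ : Matrix ((a × b) × (c × d)) ((a × b) × (c × d)) ℂ) : Matrix c c ℂ :=
  traceRight (margCD ρ)

/-- The reduced density matrix `ρ_BC`. -/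
def margBC (ρ : Matrix ((a × b) × (c × d)) ((a × b) × (c × d)) ℂ) : Matrix (b × c) (b × c) ℂ :=
  Matrix.of fun p q => ∑ i : a, ∑ l : d, ρ ((i, p.1), (p.2, l)) ((i, q.1), (q.2, l))

/-- The reduced density matrix `ρ_ABC`. -/
def margABC (ρ : Matrix ((a × b) × (c × d)) ((a × b) × (c × d)) ℂ) :
    Matrix ((a × b) × c) ((a × b) × c) ℂ :=
  Matrix.of fun p q => ∑ l : d, ρ (p.1, (p.2, l)) (q.1, (q.2, l))

/-- The reduced density matrix `ρ_BCD`. -/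
def margBCD (ρ : Matrix ((a × b) × (c × d)) ((a × b) × (c × d)) ℂ) :
    Matrix (b × (c × d)) (b × (c × d)) ℂ :=
  Matrix.of fun p q => ∑ i : a, ρ ((i, p.1), p.2) ((i, q.1), q.2)

/-- The conditional mutual information `I(A:C|B) = S(AB) + S(BC) - S(B) - S(ABC)`. -/
noncomputable def cmiACgivenB (ρ : Matrix ((a × b) × (c × d)) ((a × b) × (c × d)) ℂ) : ℝ :=
  entropy (margAB ρ) + entropy (margBC ρ) - entropy (margB ρ) - entropy (margABC ρ)

/-- The conditional mutual information `I(B:D|C) = S(BC) + S(CD) - S(C) - S(BCD)`. -/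
noncomputable def cmiBDgivenC (ρ : Matrix ((a × b) × (c × d)) ((a × b) × (c × d)) ℂ) : ℝ :=
  entropy (margBC ρ) + entropy (margCD ρ) - entropy (margC ρ) - entropy (margBCD ρ)

/-- The conditional mutual information `I(A:D|BC) = S(ABC) + S(BCD) - S(BC) - S(ABCD)`. -/
noncomputable def cmiADgivenBC (ρ : Matrix ((a × b) × (c × d)) ((a × b) × (c × d)) ℂ) : ℝ :=
  entropy (margABC ρ) + entropy (margBCD ρ) - entropy (margBC ρ) - entropy ρ

/-- The intermediate state on `ABC`: the twirled Petz map `P_{B → AB}` applied to `ρ_BC`. -/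
noncomputable def intermediate (ρ : Matrix ((a × b) × (c × d)) ((a × b) × (c × d)) ℂ) (t : ℝ) :
    Matrix ((a × b) × c) ((a × b) × c) ℂ :=
  onLeft (petzLeft (margAB ρ) t) (margBC ρ)

/-- The recovered state on `ABCD`: first `P_{B → AB}` acts on `ρ_BC`, then `P_{C → CD}` acts on the
result, with the same parameter `t` in both maps. -/
noncomputable def recovered (ρ : Matrix ((a × b) × (c × d)) ((a × b) × (c × d)) ℂ) (t : ℝ) :
    Matrix ((a × b) × (c × d)) ((a × b) × (c × d)) ℂ :=
  onRight (petzRight (margCD ρ) t) (intermediate ρ t)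

end FourSystems

end QRecovery

/-! The argument is complex interpolation on the strip 0 ≤ Re z ≤ 1. Put g(z) = ρ_BC^{z/2}
ρ_B^{-z/2} ρ_AB^{z/2} ρ_C^{-z/2} ρ_CD^{z/2}, each factor tensored with identities, and f(z) =
Tr[g(z) ρ^{1-z/2}].

On Re z = 0 every power is a contraction, so |f| ≤ 1, and f(0) = 1. On Re z = 1 the two Petz maps
unfold to g(1+it)† g(1+it), the recovered state (`recovered_eq`), while ρ^{1-z/2} is √ρ times a
contraction; hence |f(1+it)| is at most the fidelity (`norm_trace_le_fidelity`). The logarithmic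
derivative of f at 0 is a sum of terms ±½ Tr[ρ_R log ρ_R], and it equals minus half the sum of the
three conditional mutual informations, because S(ABC), S(BCD) and one S(BC) cancel. The three lines
theorem, differentiated at the boundary point 0, gives exp(Re f'(0)) ≤ |f(1+it)| for some t
(`exists_exp_deriv_le_norm`).

Invertibility is not needed: g(0) is only a product of support projections, but each of them fixes ρ
from both sides (`IsMarginal.mul_supportPow_zero`), which is enough for f(0) and f'(0). -/

namespace QRecovery

/-! ### Functional calculus and complex powers on the support. -/

section SpectralFunctions

open scoped Matrix.Norms.L2Operator
open Matrix

variable {n : Type*} [Fintype n] [DecidableEq n] {A : Matrix n n ℂ}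

/-- The matrix obtained from a Hermitian matrix by applying a complex-valued function to its
eigenvalues. -/
noncomputable def spectralFun (hA : A.IsHermitian) (f : ℝ → ℂ) : Matrix n n ℂ :=
  (hA.eigenvectorUnitary : Matrix n n ℂ) * Matrix.diagonal (fun i => f (hA.eigenvalues i)) *
    (hA.eigenvectorUnitary : Matrix n n ℂ).conjTranspose

theorem eigenvectorUnitary_conjTranspose_mul (hA : A.IsHermitian) :
    (hA.eigenvectorUnitary : Matrix n n ℂ)ᴴ * (hA.eigenvectorUnitary : Matrix n n ℂ) = 1 :=
  Unitary.coe_star_mul_self hA.eigenvectorUnitary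

theorem spectralFun_congr (hA : A.IsHermitian) {f g : ℝ → ℂ}
    (h : ∀ i, f (hA.eigenvalues i) = g (hA.eigenvalues i)) :
    spectralFun hA f = spectralFun hA g := by
  simp only [spectralFun, h]

theorem spectralFun_mul (hA : A.IsHermitian) (f g : ℝ → ℂ) :
    spectralFun hA f * spectralFun hA g = spectralFun hA (fun x => f x * g x) := by
  have hU := eigenvectorUnitary_conjTranspose_mul hA
  simp only [spectralFun]
  rw [← Matrix.diagonal_mul_diagonal]
  simp only [Matrix.mul_assoc]
  rw [← Matrix.mul_assoc _ᴴ (hA.eigenvectorUnitary : Matrix n n ℂ), hU, Matrix.one_mul]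

theorem spectralFun_conjTranspose (hA : A.IsHermitian) (f : ℝ → ℂ) :
    (spectralFun hA f)ᴴ = spectralFun hA (fun x => star (f x)) := by
  simp only [spectralFun, conjTranspose_mul, conjTranspose_conjTranspose, diagonal_conjTranspose,
    Matrix.mul_assoc]
  rfl

theorem spectralFun_ofReal (hA : A.IsHermitian) : spectralFun hA (fun x => (x : ℂ)) = A :=
  hA.spectral_theorem.symm

theorem cfc_eq_spectralFun (hA : A.IsHermitian) (f : ℝ → ℝ) :
    cfc f A = spectralFun hA (fun x => (f x : ℂ)) :=
  hA.cfc_eq f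

theorem trace_spectralFun (hA : A.IsHermitian) (f : ℝ → ℂ) :
    (spectralFun hA f).trace = ∑ i, f (hA.eigenvalues i) := by
  rw [spectralFun, Matrix.trace_mul_comm, ← Matrix.mul_assoc,
    eigenvectorUnitary_conjTranspose_mul, Matrix.one_mul, Matrix.trace_diagonal]

theorem norm_spectralFun_le (hA : A.IsHermitian) {f : ℝ → ℂ} {C : ℝ} (hC : 0 ≤ C)
    (h : ∀ i, ‖f (hA.eigenvalues i)‖ ≤ C) : ‖spectralFun hA f‖ ≤ C := by
  have hD : ‖Matrix.diagonal (fun i => f (hA.eigenvalues i))‖ ≤ C := by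
    rw [Matrix.l2_opNorm_diagonal]
    exact (pi_norm_le_iff_of_nonneg hC).2 h
  have hmem : (hA.eigenvectorUnitary : Matrix n n ℂ) ∈ unitary (Matrix n n ℂ) :=
    hA.eigenvectorUnitary.2
  have hmem' : star (hA.eigenvectorUnitary : Matrix n n ℂ) ∈ unitary (Matrix n n ℂ) :=
    Unitary.star_mem hmem
  rw [spectralFun, ← Matrix.star_eq_conjTranspose, CStarRing.norm_mul_mem_unitary _ hmem',
    CStarRing.norm_mem_unitary_mul _ hmem]
  exact hD

theorem supportPow_eq_spectralFun (hA : A.IsHermitian) (z : ℂ) :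
    supportPow A z = spectralFun hA (fun x => if x = 0 then 0 else (x : ℂ) ^ z) := by
  simp only [supportPow, hA, dif_pos, spectralFun]

theorem supportPow_mul (hA : A.IsHermitian) (z w : ℂ) :
    supportPow A z * supportPow A w = supportPow A (z + w) := by
  simp only [supportPow_eq_spectralFun hA, spectralFun_mul]
  congr 1
  funext x
  split_ifs with hx
  · simp
  · rw [Complex.cpow_add _ _ (by exact_mod_cast hx)]

theorem supportPow_one (hA : A.IsHermitian) : supportPow A 1 = A := by
  conv_rhs => rw [← spectralFun_ofReal hA]
  rw [supportPow_eq_spectralFun hA]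
  congr 1
  funext x
  split_ifs with hx <;> simp [hx]

theorem supportPow_conjTranspose (hA : A.PosSemidef) (z : ℂ) :
    (supportPow A z)ᴴ = supportPow A (star z) := by
  simp only [supportPow_eq_spectralFun hA.isHermitian, spectralFun_conjTranspose]
  refine spectralFun_congr _ fun i => ?_
  split_ifs with hx
  · simp
  · have h0 := hA.eigenvalues_nonneg i
    have harg : Complex.arg ((hA.isHermitian.eigenvalues i : ℝ) : ℂ) ≠ Real.pi := by
      rw [Complex.arg_ofReal_of_nonneg h0]
      exact Real.pi_pos.ne
    have := Complex.cpow_conj (hA.isHermitian.eigenvalues i : ℂ) z harg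
    rw [Complex.conj_ofReal] at this
    exact this.symm

/-- The modulus |p^z| = exp(Re z · log p) is at most exp|log p|, and the kernel contributes zero; so
negative exponents do no harm. -/
theorem norm_supportPow_le (hA : A.PosSemidef) :
    ∃ C : ℝ, ∀ z : ℂ, |z.re| ≤ 1 → ‖supportPow A z‖ ≤ C := by
  refine ⟨∑ i, Real.exp |Real.log (hA.isHermitian.eigenvalues i)|, fun z hz => ?_⟩
  rw [supportPow_eq_spectralFun hA.isHermitian]
  refine norm_spectralFun_le _ (by positivity) fun i => ?_
  refine le_trans ?_ (Finset.single_le_sum (fun j _ => (Real.exp_pos _).le) (Finset.mem_univ i))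
  split_ifs with hx
  · simpa using (Real.exp_pos _).le
  · have h0 := lt_of_le_of_ne (hA.eigenvalues_nonneg i) (Ne.symm hx)
    rw [Complex.norm_cpow_eq_rpow_re_of_pos h0, Real.rpow_def_of_pos h0]
    refine Real.exp_le_exp.2 ((le_abs_self _).trans ?_)
    rw [abs_mul]
    exact mul_le_of_le_one_right (abs_nonneg _) hz

theorem norm_supportPow_le_one (hA : A.PosSemidef) {z : ℂ} (hz : z.re = 0) :
    ‖supportPow A z‖ ≤ 1 := by
  rw [supportPow_eq_spectralFun hA.isHermitian]
  refine norm_spectralFun_le _ zero_le_one fun i => ?_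
  split_ifs with hx
  · simp
  · have h0 := lt_of_le_of_ne (hA.eigenvalues_nonneg i) (Ne.symm hx)
    rw [Complex.norm_cpow_eq_rpow_re_of_pos h0, hz, Real.rpow_zero]

theorem hasDerivAt_supportPow (hA : A.PosSemidef) (z : ℂ) :
    HasDerivAt (supportPow A)
      (spectralFun hA.isHermitian (fun x => if x = 0 then 0 else (x : ℂ) ^ z * Real.log x)) z := by
  have hD : HasDerivAt (fun w => Matrix.diagonal (fun i => if hA.isHermitian.eigenvalues i = 0 then 0
      else (hA.isHermitian.eigenvalues i : ℂ) ^ w))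
      (Matrix.diagonal (fun i => if hA.isHermitian.eigenvalues i = 0 then 0
      else (hA.isHermitian.eigenvalues i : ℂ) ^ z * Real.log (hA.isHermitian.eigenvalues i))) z := by
    have h1 : HasDerivAt (fun w => (fun i => if hA.isHermitian.eigenvalues i = 0 then (0 : ℂ)
      else (hA.isHermitian.eigenvalues i : ℂ) ^ w))
      (fun i => if hA.isHermitian.eigenvalues i = 0 then 0
      else (hA.isHermitian.eigenvalues i : ℂ) ^ z * Real.log (hA.isHermitian.eigenvalues i)) z := by
      refine hasDerivAt_pi.2 fun i => ?_
      by_cases hx : hA.isHermitian.eigenvalues i = 0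
      · simpa [hx] using hasDerivAt_const z (0 : ℂ)
      · simp only [hx, if_false]
        have h2 := (hasDerivAt_id z).const_cpow (c := (hA.isHermitian.eigenvalues i : ℂ))
          (Or.inl (by exact_mod_cast hx))
        simpa [Complex.ofReal_log (hA.eigenvalues_nonneg i)] using h2
    exact ((Matrix.diagonalLinearMap n ℂ ℂ).toContinuousLinearMap.hasFDerivAt).comp_hasDerivAt z h1
  have hfun : supportPow A = fun w => spectralFun hA.isHermitian
      (fun x => if x = 0 then 0 else (x : ℂ) ^ w) :=
    funext fun w => supportPow_eq_spectralFun hA.isHermitian w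
  rw [hfun]
  exact (hD.const_mul _).mul_const _

theorem hasDerivAt_supportPow_zero (hA : A.PosSemidef) :
    HasDerivAt (supportPow A) (spectralFun hA.isHermitian (fun x => (Real.log x : ℂ))) 0 := by
  convert! hasDerivAt_supportPow hA 0 using 1
  congr 1
  funext x
  -- On the kernel the support power is constantly zero, which agrees with the convention `Real.log
  -- 0 = 0`.
  split_ifs with hx <;> simp [hx]

theorem hasDerivAt_supportPow_one (hA : A.PosSemidef) :
    HasDerivAt (supportPow A) (spectralFun hA.isHermitian (fun x => (x : ℂ) * (Real.log x : ℂ))) 1 := by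
  convert! hasDerivAt_supportPow hA 1 using 1
  congr 1
  funext x
  split_ifs with hx <;> simp [hx]

theorem trace_spectralFun_mul_log (hA : A.IsHermitian) :
    (spectralFun hA (fun x => (x : ℂ) * (Real.log x : ℂ))).trace = -(entropy A : ℂ) := by
  rw [entropy, cfc_eq_spectralFun hA, trace_spectralFun, trace_spectralFun]
  simp [Real.negMulLog]

theorem trace_log_mul_self (hA : A.IsHermitian) :
    (spectralFun hA (fun x => (Real.log x : ℂ)) * A).trace = -(entropy A : ℂ) := by
  conv_lhs => enter [1, 2]; rw [← spectralFun_ofReal hA]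
  rw [spectralFun_mul, ← trace_spectralFun_mul_log hA]
  simp only [mul_comm]

theorem supportPow_zero_mul_self (hA : A.IsHermitian) : supportPow A 0 * A = A := by
  conv_lhs => enter [2]; rw [← supportPow_one hA]
  rw [supportPow_mul hA, zero_add, supportPow_one hA]

end SpectralFunctions

/-! ### Trace duality and a lower bound for the fidelity. -/

section TraceNorm

variable {n : Type*} [Fintype n] [DecidableEq n]

theorem posSemidef_sqrt (A : Matrix n n ℂ) : (CFC.sqrt A).PosSemidef :=
  Matrix.nonneg_iff_posSemidef.1 (CFC.sqrt_nonneg A)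

theorem sqrt_mul_sqrt {A : Matrix n n ℂ} (hA : A.PosSemidef) : CFC.sqrt A * CFC.sqrt A = A :=
  CFC.sqrt_mul_sqrt_self A (Matrix.nonneg_iff_posSemidef.2 hA)

theorem sqrt_eq_supportPow {A : Matrix n n ℂ} (hA : A.PosSemidef) :
    CFC.sqrt A = supportPow A (1 / 2) := by
  refine CFC.sqrt_unique ?_ ?_
  · rw [supportPow_mul hA.isHermitian]
    norm_num [supportPow_one hA.isHermitian]
  · rw [Matrix.nonneg_iff_posSemidef]
    have h : supportPow A (1 / 2) = supportPow A (1 / 4) * (supportPow A (1 / 4)).conjTranspose := by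
      rw [supportPow_conjTranspose hA, supportPow_mul hA.isHermitian]
      congr 1
      norm_num [Complex.ext_iff]
    rw [h]
    exact Matrix.posSemidef_self_mul_conjTranspose _

open scoped Matrix.Norms.L2Operator
open Matrix

/-- In an eigenbasis of P the trace is a sum of eigenvalues weighted by diagonal entries of a
contraction. -/
theorem norm_trace_mul_le {P : Matrix n n ℂ} (hP : P.PosSemidef) {Y : Matrix n n ℂ}
    (hY : ‖Y‖ ≤ 1) : ‖(Y * P).trace‖ ≤ P.trace.re := by
  set U : Matrix n n ℂ := (hP.isHermitian.eigenvectorUnitary : Matrix n n ℂ) with hU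
  have hUU : Uᴴ * U = 1 := eigenvectorUnitary_conjTranspose_mul hP.isHermitian
  have hPs : P = U * diagonal (fun i => (hP.isHermitian.eigenvalues i : ℂ)) * Uᴴ :=
    hP.isHermitian.spectral_theorem
  have hmem : U ∈ unitary (Matrix n n ℂ) := hP.isHermitian.eigenvectorUnitary.2
  have hZ : ‖Uᴴ * Y * U‖ ≤ 1 := by
    rw [CStarRing.norm_mul_mem_unitary _ hmem, ← star_eq_conjTranspose,
      CStarRing.norm_mem_unitary_mul _ (Unitary.star_mem hmem)]
    exact hY
  have hentry : ∀ i, ‖(Uᴴ * Y * U) i i‖ ≤ 1 := by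
    intro i
    have h1 := Matrix.l2_opNorm_mulVec (Uᴴ * Y * U) (EuclideanSpace.single i (1 : ℂ))
    have h2 := PiLp.norm_apply_le
      (WithLp.toLp 2 ((Uᴴ * Y * U) *ᵥ (EuclideanSpace.single i (1 : ℂ)).ofLp)) i
    simp at h1 h2
    exact h2.trans (h1.trans hZ)
  have htr : (Y * P).trace = ∑ i, (Uᴴ * Y * U) i i * (hP.isHermitian.eigenvalues i : ℂ) := by
    conv_lhs => rw [hPs]
    rw [← Matrix.mul_assoc, ← Matrix.mul_assoc, Matrix.trace_mul_comm, ← Matrix.mul_assoc,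
      ← Matrix.mul_assoc]
    simp [Matrix.trace, Matrix.mul_diagonal]
  rw [htr, hP.isHermitian.trace_eq_sum_eigenvalues]
  refine (norm_sum_le _ _).trans ?_
  simp only [Complex.coe_algebraMap, Complex.re_sum]
  refine Finset.sum_le_sum fun i _ => ?_
  rw [norm_mul, Complex.norm_of_nonneg (hP.eigenvalues_nonneg i)]
  simpa using mul_le_of_le_one_left (hP.eigenvalues_nonneg i) (hentry i)

/-- Polar decomposition, with a contraction as the angular part. -/
theorem exists_contraction_mul_sqrt (X : Matrix n n ℂ) :
    ∃ V : Matrix n n ℂ, ‖V‖ ≤ 1 ∧ V * CFC.sqrt (Xᴴ * X) = X := by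
  have hS : (Xᴴ * X).PosSemidef := posSemidef_conjTranspose_mul_self X
  set S := Xᴴ * X with hSdef
  have hstar : ∀ r : ℝ, star (r : ℂ) = r := fun r => Complex.conj_ofReal r
  -- With V = X S^{-1/2}, V†V is the support projection of S = X†X, hence ‖V‖ ≤ 1.
  refine ⟨X * supportPow S (-1 / 2), ?_, ?_⟩
  · have h : ‖(X * supportPow S (-1 / 2))ᴴ * (X * supportPow S (-1 / 2))‖ ≤ 1 := by
      have : (X * supportPow S (-1 / 2))ᴴ * (X * supportPow S (-1 / 2)) = supportPow S 0 := by
        rw [conjTranspose_mul, supportPow_conjTranspose hS]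
        calc _ = supportPow S (star (-1 / 2)) * S * supportPow S (-1 / 2) := by
              simp only [hSdef, Matrix.mul_assoc]
          _ = supportPow S (star (-1 / 2)) * supportPow S 1 * supportPow S (-1 / 2) := by
              rw [supportPow_one hS.isHermitian]
          _ = _ := by
              rw [supportPow_mul hS.isHermitian, supportPow_mul hS.isHermitian]
              congr 1
              norm_num [Complex.ext_iff]
      rw [this]
      exact norm_supportPow_le_one hS (by simp)
    rw [l2_opNorm_conjTranspose_mul_self] at h
    nlinarith [norm_nonneg (X * supportPow S (-1 / 2))]
  · rw [sqrt_eq_supportPow hS, Matrix.mul_assoc, supportPow_mul hS.isHermitian]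
    norm_num
    -- X vanishes on the kernel of S, since the Gram matrix of X(S⁰ - 1) is (S⁰ - 1)S(S⁰ - 1) = 0.
    have h0 : (X * (supportPow S 0 - 1))ᴴ * (X * (supportPow S 0 - 1)) = 0 := by
      have h1 : S * (supportPow S 0 - 1) = 0 := by
        rw [Matrix.mul_sub, Matrix.mul_one, sub_eq_zero]
        conv_lhs => enter [1]; rw [← supportPow_one hS.isHermitian]
        rw [supportPow_mul hS.isHermitian, add_zero, supportPow_one hS.isHermitian]
      rw [conjTranspose_mul, Matrix.mul_assoc, ← Matrix.mul_assoc Xᴴ, ← hSdef, h1, Matrix.mul_zero]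
    rw [conjTranspose_mul_self_eq_zero, Matrix.mul_sub, Matrix.mul_one, sub_eq_zero] at h0
    exact h0

theorem norm_trace_mul_le_traceNorm (X : Matrix n n ℂ) {Y : Matrix n n ℂ} (hY : ‖Y‖ ≤ 1) :
    ‖(Y * X).trace‖ ≤ traceNorm X := by
  obtain ⟨V, hV, hVX⟩ := exists_contraction_mul_sqrt X
  conv_lhs => rw [← hVX]
  rw [← Matrix.mul_assoc]
  exact norm_trace_mul_le (posSemidef_sqrt _)
    ((norm_mul_le _ _).trans (mul_le_one₀ hY (norm_nonneg _) hV))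

/-- Writing G† = V√(GG†) turns the trace, up to complex conjugation, into the pairing of √ρ√(GG†)
with the contraction (YV)†. Any factor G of the second state will do, so its square root never has
to be computed. -/
theorem norm_trace_le_fidelity (ρ G : Matrix n n ℂ) {Y : Matrix n n ℂ} (hY : ‖Y‖ ≤ 1) :
    ‖(Gᴴ * CFC.sqrt ρ * Y).trace‖ ≤ fidelity ρ (G * Gᴴ) := by
  obtain ⟨V, hV, hVG⟩ := exists_contraction_mul_sqrt Gᴴ
  rw [conjTranspose_conjTranspose] at hVG
  have h1 : ((Y * V)ᴴ * (CFC.sqrt ρ * CFC.sqrt (G * Gᴴ))).trace =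
      star ((Gᴴ * CFC.sqrt ρ * Y).trace) := by
    have hS := (posSemidef_sqrt (G * Gᴴ)).isHermitian.eq
    generalize CFC.sqrt (G * Gᴴ) = S at hVG hS ⊢
    rw [← Matrix.trace_conjTranspose, ← hVG]
    simp only [conjTranspose_mul, (posSemidef_sqrt ρ).isHermitian.eq, hS]
    rw [Matrix.mul_assoc, Matrix.trace_mul_comm]
    simp only [Matrix.mul_assoc]
  have h2 := norm_trace_mul_le_traceNorm (CFC.sqrt ρ * CFC.sqrt (G * Gᴴ)) (Y := (Y * V)ᴴ)
    (by rw [l2_opNorm_conjTranspose]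
        exact (norm_mul_le _ _).trans (mul_le_one₀ hY (norm_nonneg _) hV))
  rw [h1, norm_star] at h2
  exact h2

end TraceNorm

/-! ### The three lines theorem differentiated at a boundary point. -/

section ThreeLines

open Complex Complex.HadamardThreeLines Set

/-- A form of the three lines theorem at a boundary point, in which the supremum over the right
edge of the strip is replaced by an actual value. -/
theorem exists_exp_deriv_le_norm {f : ℂ → ℂ} {f' : ℂ} (hf : Differentiable ℂ f) {C : ℝ}
    (hC : ∀ z : ℂ, z.re ∈ Icc (0 : ℝ) 1 → ‖f z‖ ≤ C) (h0 : ∀ z : ℂ, z.re = 0 → ‖f z‖ ≤ 1)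
    (hf0 : f 0 = 1) (hf' : HasDerivAt f f' 0) :
    ∃ t : ℝ, Real.exp f'.re ≤ ‖f (1 + t * I)‖ := by
  by_contra! hlt
  -- If the bound failed everywhere on the right edge, compactness would leave a uniform gap on a
  -- bounded window.
  obtain ⟨δ, hδ, hδle⟩ : ∃ δ > 0, ∀ t ∈ Icc (-2 : ℝ) 2,
      ‖f (1 + t * I)‖ ≤ Real.exp (f'.re - 2 * δ) := by
    have hcont : ContinuousOn (fun t : ℝ => ‖f (1 + t * I)‖) (Icc (-2 : ℝ) 2) := by
      have := hf.continuous
      fun_prop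
    obtain ⟨t₀, _, ht₀⟩ := isCompact_Icc.exists_isMaxOn ⟨0, by norm_num⟩ hcont
    have h1 : Filter.Tendsto (fun δ : ℝ => Real.exp (f'.re - 2 * δ)) (nhdsWithin 0 (Ioi 0))
        (nhds (Real.exp f'.re)) := by
      have : Continuous (fun δ : ℝ => Real.exp (f'.re - 2 * δ)) := by fun_prop
      simpa using (this.tendsto 0).mono_left nhdsWithin_le_nhds
    obtain ⟨δ, h2, h3⟩ := ((h1.eventually_const_lt (hlt t₀)).and self_mem_nhdsWithin).exists
    exact ⟨δ, h3, fun t ht => (ht₀ ht).trans h2.le⟩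
  -- The multiplier has modulus exp(δ(x + x² - y²)). It is at most 1 on the left edge; on the right
  -- edge it is exp(δ(2 - y²)), absorbed by the gap 2δ for |y| ≤ 2 and at most 1 beyond. The linear
  -- term raises the derivative at 0 by δ, which makes the contradiction strict.
  set g : ℂ → ℂ := fun z => f z * cexp (δ * (z + z ^ 2)) with hg
  have hgd : Differentiable ℂ g := by fun_prop
  have hnorm : ∀ z : ℂ, ‖g z‖ = ‖f z‖ * Real.exp (δ * (z.re + z.re ^ 2 - z.im ^ 2)) := by
    intro z
    rw [hg, norm_mul, Complex.norm_exp]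
    congr 2
    simp only [pow_two, add_re, mul_re, ofReal_re, ofReal_im, zero_mul, sub_zero]
    ring
  have hC0 : 0 ≤ C := (norm_nonneg _).trans (hC 0 (by simp))
  have hbound : ∀ x ∈ Icc (0 : ℝ) 1, ‖g x‖ ≤ Real.exp f'.re ^ x := by
    intro x hx
    have := norm_le_interp_of_mem_verticalClosedStrip₀₁' g (z := x) (a := 1) (b := Real.exp f'.re)
      (by simpa [verticalClosedStrip] using hx) hgd.diffContOnCl ?_ ?_ ?_
    · simpa using this
    · refine ⟨C * Real.exp (δ * 2), ?_⟩
      rintro _ ⟨z, hz, rfl⟩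
      simp only [verticalClosedStrip, mem_preimage] at hz
      simp only [Function.comp_apply, hnorm]
      refine mul_le_mul (hC z hz) (Real.exp_le_exp.2 ?_) (Real.exp_pos _).le hC0
      have := hz.1
      have := hz.2
      gcongr
      nlinarith [sq_nonneg z.im]
    · intro z hz
      have hz : z.re = 0 := hz
      rw [hnorm, hz]
      refine mul_le_one₀ (h0 z hz) (Real.exp_pos _).le ?_
      rw [Real.exp_le_one_iff]
      nlinarith [mul_nonneg hδ.le (sq_nonneg z.im)]
    · intro z hz
      have hz : z.re = 1 := hz
      have hzz : z = 1 + (z.im : ℝ) * I := by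
        apply Complex.ext <;> simp [hz]
      rw [hnorm, hz]
      by_cases ht : z.im ∈ Icc (-2 : ℝ) 2
      · have h1 := hδle _ ht
        rw [← hzz] at h1
        calc _ ≤ Real.exp (f'.re - 2 * δ) * Real.exp (δ * 2) := by
              refine mul_le_mul h1 (Real.exp_le_exp.2 ?_) (Real.exp_pos _).le (Real.exp_pos _).le
              gcongr
              nlinarith [sq_nonneg z.im]
          _ = _ := by rw [← Real.exp_add]; ring_nf
      · have h1 := (hlt z.im).le
        rw [← hzz] at h1
        refine (mul_le_of_le_one_right (norm_nonneg _) ?_).trans h1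
        rw [Real.exp_le_one_iff]
        refine mul_nonpos_of_nonneg_of_nonpos hδ.le ?_
        by_contra! hneg
        exact ht (abs_le.1 (abs_le_of_sq_le_sq (by nlinarith) (by norm_num)))
  have hgder : HasDerivAt g (f' + δ) 0 := by
    have h1 : HasDerivAt (fun z : ℂ => cexp (δ * (z + z ^ 2))) (δ : ℂ) 0 := by
      have := ((((hasDerivAt_id (0 : ℂ)).add ((hasDerivAt_id (0 : ℂ)).pow 2)).const_mul
        (δ : ℂ))).cexp
      simpa using this
    have h2 := hf'.mul h1
    simp only [hf0, add_zero, ne_eq, OfNat.ofNat_ne_zero, not_false_eq_true, zero_pow, mul_zero,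
      Complex.exp_zero, mul_one, one_mul] at h2
    exact h2
  have hre : HasDerivAt (fun x : ℝ => (g x).re) (f' + δ).re 0 :=
    HasDerivAt.real_of_complex (z := 0) (by simpa using hgder)
  have hexp : HasDerivAt (fun x : ℝ => Real.exp f'.re ^ x) f'.re 0 := by
    simpa using (hasDerivAt_id (0 : ℝ)).const_rpow (Real.exp_pos f'.re)
  -- The difference exp(f'.re)^x - Re g(x) vanishes at 0 and is nonnegative on (0, 1), yet its
  -- derivative at 0 is -δ < 0.
  have hdiff := hexp.sub hre
  have hneg : f'.re - (f' + δ).re < 0 := by simpa using hδ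
  have hslope := (hasDerivAt_iff_tendsto_slope.1 hdiff).mono_left
    (nhdsWithin_mono (0 : ℝ) (fun x (hx : x ∈ Ioi (0 : ℝ)) => ne_of_gt hx))
  have hev := (hslope.eventually_lt_const hneg).and
    (Ioo_mem_nhdsGT (zero_lt_one : (0 : ℝ) < 1))
  obtain ⟨x, h1, h2⟩ := hev.exists
  have h3 := (Complex.re_le_norm _).trans (hbound x ⟨h2.1.le, h2.2.le⟩)
  have hg0 : g 0 = 1 := by simp [hg, hf0]
  rw [slope_def_field] at h1
  have h4 : 0 ≤ (Real.exp f'.re ^ x - (g x).re) / x := div_nonneg (by linarith) h2.1.le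
  refine absurd h1 (not_lt.2 ?_)
  simpa [hg0] using h4

end ThreeLines

/-! ### Marginals and the interpolating operator function. -/

section Factors

open scoped Matrix.Norms.L2Operator
open Matrix Set

variable {n r q : Type*} [Fintype n] [DecidableEq n] [Fintype r] [DecidableEq r]
  [Fintype q] [DecidableEq q]

/-- `R` is the reduced state of `ρ` on the subsystem whose observables are embedded by `ι`. -/
def IsMarginal (ι : Matrix r r ℂ →⋆ₐ[ℂ] Matrix n n ℂ) (R : Matrix r r ℂ) (ρ : Matrix n n ℂ) :
    Prop :=
  ∀ X, (ι X * ρ).trace = (X * R).trace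

theorem IsMarginal.comp {ι : Matrix r r ℂ →⋆ₐ[ℂ] Matrix n n ℂ}
    {κ : Matrix q q ℂ →⋆ₐ[ℂ] Matrix r r ℂ} {ρ : Matrix n n ℂ} {R : Matrix r r ℂ}
    {T : Matrix q q ℂ} (h₁ : IsMarginal ι R ρ) (h₂ : IsMarginal κ T R) :
    IsMarginal (ι.comp κ) T ρ :=
  fun X => (h₁ (κ X)).trans (h₂ X)

/-- The trace Tr[Qρ] is the squared Hilbert–Schmidt norm of √ρ Q. -/
theorem mul_eq_zero_of_trace_mul_eq_zero {ρ Q : Matrix n n ℂ} (hρ : ρ.PosSemidef)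
    (hQ : Qᴴ = Q) (hQQ : Q * Q = Q) (h : (Q * ρ).trace = 0) : ρ * Q = 0 := by
  have hS := (posSemidef_sqrt ρ).isHermitian.eq
  have hSS := sqrt_mul_sqrt hρ
  have h1 : ((CFC.sqrt ρ * Q)ᴴ * (CFC.sqrt ρ * Q)).trace = 0 := by
    rw [conjTranspose_mul, hS, hQ]
    calc _ = (Q * (CFC.sqrt ρ * CFC.sqrt ρ) * Q).trace := by simp only [Matrix.mul_assoc]
      _ = 0 := by rw [hSS, Matrix.trace_mul_comm, ← Matrix.mul_assoc, hQQ, h]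
  rw [trace_conjTranspose_mul_self_eq_zero_iff] at h1
  rw [← hSS, Matrix.mul_assoc, h1, Matrix.mul_zero]

/-- The support of a state lies in that of each marginal: the kernel projection 1 - R⁰ has
expectation Tr[(1 - R⁰)R] = 0. -/
theorem IsMarginal.mul_supportPow_zero {ι : Matrix r r ℂ →⋆ₐ[ℂ] Matrix n n ℂ} {R : Matrix r r ℂ}
    {ρ : Matrix n n ℂ} (h : IsMarginal ι R ρ) (hR : R.PosSemidef) (hρ : ρ.PosSemidef) :
    ρ * ι (supportPow R 0) = ρ := by
  have hP : (supportPow R 0)ᴴ = supportPow R 0 := by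
    rw [supportPow_conjTranspose hR, star_zero]
  have hPP : supportPow R 0 * supportPow R 0 = supportPow R 0 := by
    rw [supportPow_mul hR.isHermitian, add_zero]
  have hQ : ρ * ι (1 - supportPow R 0) = 0 := by
    refine mul_eq_zero_of_trace_mul_eq_zero hρ ?_ ?_ ?_
    · rw [← star_eq_conjTranspose, ← map_star, star_sub, star_one, star_eq_conjTranspose, hP]
    · rw [← map_mul]
      congr 1
      simp [sub_mul, mul_sub, hPP]
    · rw [h, Matrix.sub_mul, Matrix.one_mul, supportPow_zero_mul_self hR.isHermitian, sub_self,
        Matrix.trace_zero]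
  rw [map_sub, map_one, Matrix.mul_sub, Matrix.mul_one, sub_eq_zero] at hQ
  exact hQ.symm

/-- An operator-valued function which is contractive on the imaginary axis, acts trivially on the
state `ρ` at the origin, and whose derivative there has expectation `s` in the state `ρ`. -/
structure IsStripFactor (ρ : Matrix n n ℂ) (g : ℂ → Matrix n n ℂ) (s : ℂ) : Prop where
  differentiable : Differentiable ℂ g
  bounded : ∃ C : ℝ, ∀ z : ℂ, z.re ∈ Icc (0 : ℝ) 1 → ‖g z‖ ≤ C
  norm_le_one : ∀ z : ℂ, z.re = 0 → ‖g z‖ ≤ 1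
  zero_mul : g 0 * ρ = ρ
  mul_zero : ρ * g 0 = ρ
  deriv : ∃ L, HasDerivAt g L 0 ∧ (L * ρ).trace = s

/-- In the product rule L₁g₂(0) + g₁(0)L₂, ρ absorbs g₂(0) on one side and, by cyclicity of the
trace, g₁(0) on the other. So the expectations add although the factors need not commute. -/
theorem IsStripFactor.mul {ρ : Matrix n n ℂ} {g₁ g₂ : ℂ → Matrix n n ℂ} {s₁ s₂ : ℂ}
    (h₁ : IsStripFactor ρ g₁ s₁) (h₂ : IsStripFactor ρ g₂ s₂) :
    IsStripFactor ρ (fun z => g₁ z * g₂ z) (s₁ + s₂) where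
  differentiable := h₁.differentiable.mul h₂.differentiable
  bounded := by
    obtain ⟨C₁, hC₁⟩ := h₁.bounded
    obtain ⟨C₂, hC₂⟩ := h₂.bounded
    refine ⟨C₁ * C₂, fun z hz => (norm_mul_le _ _).trans ?_⟩
    exact mul_le_mul (hC₁ z hz) (hC₂ z hz) (norm_nonneg _) ((norm_nonneg _).trans (hC₁ z hz))
  norm_le_one z hz := (norm_mul_le _ _).trans
    (mul_le_one₀ (h₁.norm_le_one z hz) (norm_nonneg _) (h₂.norm_le_one z hz))
  zero_mul := by rw [Matrix.mul_assoc, h₂.zero_mul, h₁.zero_mul]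
  mul_zero := by rw [← Matrix.mul_assoc, h₁.mul_zero, h₂.mul_zero]
  deriv := by
    obtain ⟨L₁, hL₁, ht₁⟩ := h₁.deriv
    obtain ⟨L₂, hL₂, ht₂⟩ := h₂.deriv
    refine ⟨_, hL₁.mul hL₂, ?_⟩
    rw [Matrix.add_mul, Matrix.trace_add, Matrix.mul_assoc, h₂.zero_mul, ht₁, Matrix.mul_assoc,
      Matrix.trace_mul_comm, Matrix.mul_assoc, h₁.mul_zero, ht₂]

theorem IsMarginal.isStripFactor {ι : Matrix r r ℂ →⋆ₐ[ℂ] Matrix n n ℂ} {R : Matrix r r ℂ}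
    {ρ : Matrix n n ℂ} (h : IsMarginal ι R ρ) (hR : R.PosSemidef) (hρ : ρ.PosSemidef) (k : ℝ)
    (hk : |k| ≤ 1) :
    IsStripFactor ρ (fun z => ι (supportPow R (k * z))) (-(k * entropy R : ℝ)) := by
  have hder : ∀ {z : ℂ} {L : Matrix r r ℂ}, HasDerivAt (supportPow R) L (k * z) →
      HasDerivAt (fun z => ι (supportPow R (k * z))) (ι ((k : ℂ) • L)) z := by
    intro z L hL
    have h1 : HasDerivAt (fun w : ℂ => (k : ℂ) * w) (k : ℂ) z := by
      simpa using (hasDerivAt_id z).const_mul (k : ℂ)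
    have h2 := HasDerivAt.scomp z hL h1
    exact (LinearMap.toContinuousLinearMap
      ((ι : Matrix r r ℂ →ₐ[ℂ] Matrix n n ℂ).toLinearMap)).hasFDerivAt.comp_hasDerivAt z h2
  have hnorm : ∀ X, ‖ι X‖ ≤ ‖X‖ := fun X => NonUnitalStarAlgHom.norm_apply_le ι X
  have hPρ := h.mul_supportPow_zero hR hρ
  refine ⟨fun z => (hder (hasDerivAt_supportPow hR _)).differentiableAt, ?_, ?_, ?_, ?_, ?_⟩
  · obtain ⟨C, hC⟩ := norm_supportPow_le hR
    refine ⟨C, fun z hz => (hnorm _).trans (hC _ ?_)⟩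
    rw [Complex.re_ofReal_mul, abs_mul]
    exact mul_le_one₀ hk (abs_nonneg _) (abs_le.2 ⟨by linarith [hz.1], hz.2⟩)
  · intro z hz
    refine (hnorm _).trans (norm_supportPow_le_one hR ?_)
    rw [Complex.re_ofReal_mul, hz, mul_zero]
  · have := congrArg conjTranspose hPρ
    rw [conjTranspose_mul, hρ.isHermitian.eq, ← star_eq_conjTranspose, ← map_star,
      star_eq_conjTranspose, supportPow_conjTranspose hR, star_zero] at this
    simpa using this
  · simpa using hPρ
  · refine ⟨_, hder (z := 0) (by simpa using hasDerivAt_supportPow_zero hR), ?_⟩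
    rw [h, Matrix.smul_mul, Matrix.trace_smul, trace_log_mul_self]
    simp

/-- Interpolation is applied to Tr[g(z) ρ^{1-z/2}]. At 0, g contributes s to the derivative and the
power of ρ contributes -½ Tr[ρ log ρ] = S(ρ)/2. -/
theorem IsStripFactor.exists_exp_le_fidelity {ρ : Matrix n n ℂ} {g : ℂ → Matrix n n ℂ} {s : ℂ}
    (hg : IsStripFactor ρ g s) (hρ : IsState ρ) :
    ∃ t : ℝ, Real.exp (s.re + entropy ρ / 2) ≤
      fidelity ρ ((g (1 + t * Complex.I))ᴴ * g (1 + t * Complex.I)) := by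
  obtain ⟨hρ, htr⟩ := hρ
  have hH := hρ.isHermitian
  obtain ⟨L, hL, hLs⟩ := hg.deriv
  have hlast : ∀ {z : ℂ} {L : Matrix n n ℂ}, HasDerivAt (supportPow ρ) L (1 - z / 2) →
      HasDerivAt (fun z => supportPow ρ (1 - z / 2)) ((-(1 / 2) : ℂ) • L) z := by
    intro z L hL
    have h1 : HasDerivAt (fun w : ℂ => 1 - w / 2) (-(1 / 2) : ℂ) z := by
      simpa using ((hasDerivAt_id z).div_const 2).const_sub 1
    exact HasDerivAt.scomp z hL h1
  have htrace : ∀ {F : ℂ → Matrix n n ℂ} {F' : Matrix n n ℂ} {z : ℂ}, HasDerivAt F F' z →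
      HasDerivAt (fun z => (F z).trace) F'.trace z := by
    intro F F' z hF
    exact (LinearMap.toContinuousLinearMap
      (Matrix.traceLinearMap n ℂ ℂ)).hasFDerivAt.comp_hasDerivAt z hF
  have hsplit : ∀ z, supportPow ρ (1 - z / 2) = ρ * supportPow ρ (-z / 2) := by
    intro z
    conv_rhs => enter [1]; rw [← supportPow_one hH]
    rw [supportPow_mul hH]
    congr 1
    ring
  set f : ℂ → ℂ := fun z => (g z * supportPow ρ (1 - z / 2)).trace with hf
  have htrle : ∀ Y : Matrix n n ℂ, ‖(Y * ρ).trace‖ ≤ ‖Y‖ := by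
    intro Y
    by_cases hY : ‖Y‖ = 0
    · simp [norm_eq_zero.1 hY]
    have h1 := norm_trace_mul_le hρ (Y := ((‖Y‖⁻¹ : ℝ) : ℂ) • Y) (by
      rw [norm_smul]; simp [hY])
    rw [Matrix.smul_mul, Matrix.trace_smul, norm_smul, htr] at h1
    have h2 : 0 < ‖Y‖ := lt_of_le_of_ne (norm_nonneg _) (Ne.symm hY)
    simp only [Complex.norm_real, norm_inv, norm_norm, Complex.one_re] at h1
    rwa [inv_mul_le_iff₀ h2, mul_one] at h1
  -- Splitting off one full ρ and using cyclicity leaves the expectation of ρ^{-z/2} g(z) in a state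
  -- of trace one, so only operator norms matter.
  have hfle : ∀ z, ‖f z‖ ≤ ‖supportPow ρ (-z / 2)‖ * ‖g z‖ := by
    intro z
    have : f z = (supportPow ρ (-z / 2) * g z * ρ).trace := by
      rw [hf]
      simp only
      rw [hsplit, ← Matrix.mul_assoc, Matrix.trace_mul_comm, Matrix.mul_assoc]
    rw [this]
    exact (htrle _).trans (norm_mul_le _ _)
  obtain ⟨C₁, hC₁⟩ := hg.bounded
  obtain ⟨C₂, hC₂⟩ := norm_supportPow_le hρ
  have key : ∃ t : ℝ, Real.exp (s + entropy ρ / 2 : ℂ).re ≤ ‖f (1 + t * Complex.I)‖ := by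
    refine exists_exp_deriv_le_norm (C := C₂ * C₁)
      (fun z => (htrace ((hg.differentiable z).hasDerivAt.mul
        (hlast (hasDerivAt_supportPow hρ _)))).differentiableAt) ?_ ?_ ?_ ?_
    · intro z hz
      refine (hfle z).trans (mul_le_mul (hC₂ _ ?_) (hC₁ z hz) (norm_nonneg _)
        ((norm_nonneg _).trans (hC₂ 0 (by simp))))
      have : (-z / 2).re = -z.re / 2 := by simp
      rw [this, abs_le]
      constructor <;> linarith [hz.1, hz.2]
    · intro z hz
      refine (hfle z).trans (mul_le_one₀ (norm_supportPow_le_one hρ ?_) (norm_nonneg _)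
        (hg.norm_le_one z hz))
      simp [hz]
    · simp [hf, supportPow_one hH, hg.zero_mul, htr]
    · have h1 := htrace (hL.mul (hlast (z := 0) (by simpa using hasDerivAt_supportPow_one hρ)))
      convert! h1 using 1
      have h2 : spectralFun hH (fun x => (x : ℂ) * (Real.log x : ℂ)) =
          ρ * spectralFun hH (fun x => (Real.log x : ℂ)) := by
        conv_rhs => enter [1]; rw [← spectralFun_ofReal hH]
        rw [spectralFun_mul]
      have h3 : g 0 * spectralFun hH (fun x => (x : ℂ) * (Real.log x : ℂ)) =
          spectralFun hH (fun x => (x : ℂ) * (Real.log x : ℂ)) := by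
        rw [h2, ← Matrix.mul_assoc, hg.zero_mul]
      rw [Matrix.trace_add, Matrix.mul_smul, h3, Matrix.trace_smul, trace_spectralFun_mul_log]
      simp only [zero_div, sub_zero, supportPow_one hH, hLs, smul_eq_mul]
      ring
  obtain ⟨t, ht⟩ := key
  refine ⟨t, ?_⟩
  have hre : (s + entropy ρ / 2 : ℂ).re = s.re + entropy ρ / 2 := by
    rw [Complex.add_re]
    norm_cast
  rw [hre] at ht
  refine ht.trans ?_
  have h1 : supportPow ρ (1 - (1 + t * Complex.I) / 2) =
      CFC.sqrt ρ * supportPow ρ (-(t * Complex.I) / 2) := by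
    rw [sqrt_eq_supportPow hρ, supportPow_mul hH]
    congr 1
    ring
  have h2 := norm_trace_le_fidelity ρ (g (1 + t * Complex.I))ᴴ
    (Y := supportPow ρ (-(t * Complex.I) / 2)) (norm_supportPow_le_one hρ (by simp))
  rw [conjTranspose_conjTranspose, Matrix.mul_assoc, ← h1] at h2
  exact h2

end Factors

/-! ### Tensor embeddings, partial traces and Petz maps as sandwiches. -/

section Embeddings

open Matrix

theorem posSemidef_traceRight {m k : Type*} [Fintype k]
    {ρ : Matrix (m × k) (m × k) ℂ} (h : ρ.PosSemidef) :
    (traceRight ρ).PosSemidef := by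
  have : traceRight ρ = ∑ j, ρ.submatrix (fun i => (i, j)) (fun i => (i, j)) := by
    ext i i'
    simp [traceRight, Matrix.sum_apply]
  rw [this]
  exact posSemidef_sum _ fun j _ => h.submatrix _

theorem posSemidef_traceLeft {m k : Type*} [Fintype k]
    {ρ : Matrix (k × m) (k × m) ℂ} (h : ρ.PosSemidef) :
    (traceLeft ρ).PosSemidef := by
  have : traceLeft ρ = ∑ j, ρ.submatrix (fun i => (j, i)) (fun i => (j, i)) := by
    ext i i'
    simp [traceLeft, Matrix.sum_apply]
  rw [this]
  exact posSemidef_sum _ fun j _ => h.submatrix _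

variable {m k l : Type*} [Fintype m] [DecidableEq m] [Fintype k] [DecidableEq k]
  [Fintype l] [DecidableEq l]

/-- The embedding `X ↦ X ⊗ 1`. -/
def embedLeft (m k : Type*) [Fintype m] [DecidableEq m] [Fintype k] [DecidableEq k] :
    Matrix m m ℂ →⋆ₐ[ℂ] Matrix (m × k) (m × k) ℂ where
  toFun X := X ⊗ₖ 1
  map_one' := one_kronecker_one
  map_mul' X Y := by rw [← mul_kronecker_mul, Matrix.one_mul]
  map_zero' := zero_kronecker _
  map_add' X Y := add_kronecker _ _ _
  commutes' c := by
    simp [Algebra.algebraMap_eq_smul_one, smul_kronecker]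
  map_star' X := by simp [star_eq_conjTranspose, conjTranspose_kronecker]

/-- The embedding `X ↦ 1 ⊗ X`. -/
def embedRight (k m : Type*) [Fintype m] [DecidableEq m] [Fintype k] [DecidableEq k] :
    Matrix m m ℂ →⋆ₐ[ℂ] Matrix (k × m) (k × m) ℂ where
  toFun X := 1 ⊗ₖ X
  map_one' := one_kronecker_one
  map_mul' X Y := by rw [← mul_kronecker_mul, Matrix.one_mul]
  map_zero' := kronecker_zero _
  map_add' X Y := kronecker_add _ _ _
  commutes' c := by
    simp [Algebra.algebraMap_eq_smul_one, kronecker_smul]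
  map_star' X := by simp [star_eq_conjTranspose, conjTranspose_kronecker]

/-- Relabelling of the basis, as a star algebra homomorphism. -/
def relabel (e : m ≃ k) : Matrix k k ℂ →⋆ₐ[ℂ] Matrix m m ℂ where
  toFun X := X.submatrix e e
  map_one' := submatrix_one_equiv e
  map_mul' X Y := (submatrix_mul_equiv X Y e e e).symm
  map_zero' := rfl
  map_add' X Y := rfl
  commutes' c := by
    simp [Algebra.algebraMap_eq_smul_one, submatrix_smul]
  map_star' X := rfl

/-- The embedding `X ↦ X ⊗ 1` of the observables of `(m ⊗ k)` into those of `m ⊗ (k ⊗ l)`. -/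
def appendRight (m k l : Type*) [Fintype m] [DecidableEq m] [Fintype k] [DecidableEq k]
    [Fintype l] [DecidableEq l] :
    Matrix (m × k) (m × k) ℂ →⋆ₐ[ℂ] Matrix (m × (k × l)) (m × (k × l)) ℂ :=
  (relabel (Equiv.prodAssoc m k l).symm).comp (embedLeft (m × k) l)

/-- The embedding `X ↦ 1 ⊗ X` of the observables of `(k ⊗ l)` into those of `(m ⊗ k) ⊗ l`. -/
def appendLeft (m k l : Type*) [Fintype m] [DecidableEq m] [Fintype k] [DecidableEq k]
    [Fintype l] [DecidableEq l] :
    Matrix (k × l) (k × l) ℂ →⋆ₐ[ℂ] Matrix ((m × k) × l) ((m × k) × l) ℂ :=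
  (relabel (Equiv.prodAssoc m k l)).comp (embedRight m (k × l))

theorem embedLeft_apply (X : Matrix m m ℂ) : embedLeft m k X = X ⊗ₖ 1 := rfl

theorem embedRight_apply (X : Matrix m m ℂ) : embedRight k m X = 1 ⊗ₖ X := rfl

theorem appendRight_apply (X : Matrix (m × k) (m × k) ℂ) (p q : m × (k × l)) :
    appendRight m k l X p q =
      X (p.1, p.2.1) (q.1, q.2.1) * (1 : Matrix l l ℂ) p.2.2 q.2.2 := rfl

theorem appendLeft_apply (X : Matrix (k × l) (k × l) ℂ) (p q : (m × k) × l) :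
    appendLeft m k l X p q =
      (1 : Matrix m m ℂ) p.1.1 q.1.1 * X (p.1.2, p.2) (q.1.2, q.2) := rfl

theorem appendRight_embedRight (X : Matrix k k ℂ) :
    appendRight m k l (embedRight m k X) = embedRight m (k × l) (embedLeft k l X) := by
  ext p q
  simp [appendRight_apply, embedRight_apply, embedLeft_apply, mul_assoc]

theorem appendRight_embedLeft (X : Matrix m m ℂ) :
    appendRight m k l (embedLeft m k X) = embedLeft m (k × l) X := by
  ext p q
  simp [appendRight_apply, embedLeft_apply, one_apply, Prod.ext_iff, ← ite_and,
    and_comm]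

theorem appendLeft_embedLeft (X : Matrix k k ℂ) :
    appendLeft m k l (embedLeft k l X) = embedLeft (m × k) l (embedRight m k X) := by
  ext p q
  simp [appendLeft_apply, embedRight_apply, embedLeft_apply, mul_assoc]

theorem isMarginal_traceRight (ρ : Matrix (m × k) (m × k) ℂ) :
    IsMarginal (embedLeft m k) (traceRight ρ) ρ := by
  intro X
  simp [embedLeft_apply, Matrix.trace, Matrix.mul_apply, Fintype.sum_prod_type, traceRight,
    one_apply, Finset.mul_sum]
  exact Finset.sum_congr rfl fun i _ => Finset.sum_comm

theorem isMarginal_traceLeft (ρ : Matrix (k × m) (k × m) ℂ) :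
    IsMarginal (embedRight k m) (traceLeft ρ) ρ := by
  intro X
  simp [embedRight_apply, Matrix.trace, Matrix.mul_apply, Fintype.sum_prod_type, traceLeft,
    one_apply, Finset.mul_sum]
  rw [Finset.sum_comm]
  exact Finset.sum_congr rfl fun i _ => Finset.sum_comm

theorem isMarginal_relabel (e : m ≃ k) (ρ : Matrix m m ℂ) :
    IsMarginal (relabel e) (ρ.submatrix e.symm e.symm) ρ := by
  intro X
  have h : relabel e X * ρ = (X * ρ.submatrix e.symm e.symm).submatrix e e := by
    rw [← submatrix_mul_equiv X _ e e e, submatrix_submatrix, Equiv.symm_comp_self]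
    rfl
  rw [h]
  exact Equiv.sum_comp e fun i => (X * ρ.submatrix e.symm e.symm) i i

theorem embedLeft_mul_mul_apply (U V : Matrix m m ℂ) (Z : Matrix (m × k) (m × k) ℂ)
    (p q : m × k) :
    (embedLeft m k U * Z * embedLeft m k V) p q =
      (U * (Matrix.of fun i j => Z (i, p.2) (j, q.2)) * V) p.1 q.1 := by
  simp [embedLeft_apply, Matrix.mul_apply, Fintype.sum_prod_type, one_apply]

theorem embedRight_mul_mul_apply (U V : Matrix m m ℂ) (Z : Matrix (k × m) (k × m) ℂ)
    (p q : k × m) :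
    (embedRight k m U * Z * embedRight k m V) p q =
      (U * (Matrix.of fun i j => Z (p.1, i) (q.1, j)) * V) p.2 q.2 := by
  simp [embedRight_apply, Matrix.mul_apply, Fintype.sum_prod_type, one_apply]

/-- Once the Petz map is a sandwich of embedded operators, composing two of them reduces to
multiplicativity of star homomorphisms. -/
theorem onLeft_petzLeft (ω : Matrix (m × k) (m × k) ℂ) (t : ℝ) (X : Matrix (k × l) (k × l) ℂ) :
    onLeft (petzLeft ω t) X =
      embedLeft (m × k) l (supportPow ω (1 / 2 - Complex.I * t / 2)) *
        appendLeft m k l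
          (embedLeft k l (supportPow (traceLeft ω) (-1 / 2 + Complex.I * t / 2)) * X *
            embedLeft k l (supportPow (traceLeft ω) (-1 / 2 - Complex.I * t / 2))) *
        embedLeft (m × k) l (supportPow ω (1 / 2 + Complex.I * t / 2)) := by
  ext p q
  rw [embedLeft_mul_mul_apply]
  simp only [appendLeft_apply, embedLeft_mul_mul_apply]
  rfl

theorem onRight_petzRight (ω : Matrix (k × l) (k × l) ℂ) (t : ℝ)
    (X : Matrix (m × k) (m × k) ℂ) :
    onRight (petzRight ω t) X =
      embedRight m (k × l) (supportPow ω (1 / 2 - Complex.I * t / 2)) *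
        appendRight m k l
          (embedRight m k (supportPow (traceRight ω) (-1 / 2 + Complex.I * t / 2)) * X *
            embedRight m k (supportPow (traceRight ω) (-1 / 2 - Complex.I * t / 2))) *
        embedRight m (k × l) (supportPow ω (1 / 2 + Complex.I * t / 2)) := by
  ext p q
  rw [embedRight_mul_mul_apply]
  simp only [appendRight_apply, embedRight_mul_mul_apply]
  rfl

end Embeddings

/-! ### The four-system interpolating function and its recovered state. -/

section FourSystemRecovery

open Matrix

theorem posSemidef_margABC {a b c d : Type*} [Fintype a] [Fintype d]
    {ρ : Matrix ((a × b) × (c × d)) ((a × b) × (c × d)) ℂ}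
    (h : ρ.PosSemidef) : (margABC ρ).PosSemidef :=
  posSemidef_traceRight (h.submatrix (Equiv.prodAssoc (a × b) c d))

theorem posSemidef_margBC {a b c d : Type*} [Fintype a] [Fintype d]
    {ρ : Matrix ((a × b) × (c × d)) ((a × b) × (c × d)) ℂ}
    (h : ρ.PosSemidef) : (margBC ρ).PosSemidef :=
  posSemidef_traceLeft ((posSemidef_margABC h).submatrix (Equiv.prodAssoc a b c).symm)

variable {a b c d : Type*} [Fintype a] [DecidableEq a] [Fintype b] [DecidableEq b]
  [Fintype c] [DecidableEq c] [Fintype d] [DecidableEq d]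

theorem isMarginal_margABC (ρ : Matrix ((a × b) × (c × d)) ((a × b) × (c × d)) ℂ) :
    IsMarginal (appendRight (a × b) c d) (margABC ρ) ρ :=
  (isMarginal_relabel (Equiv.prodAssoc (a × b) c d).symm ρ).comp (isMarginal_traceRight _)

theorem isMarginal_margBC (ρ : Matrix ((a × b) × (c × d)) ((a × b) × (c × d)) ℂ) :
    IsMarginal ((appendRight (a × b) c d).comp (appendLeft a b c)) (margBC ρ) ρ :=
  (isMarginal_margABC ρ).comp
    ((isMarginal_relabel (Equiv.prodAssoc a b c) (margABC ρ)).comp (isMarginal_traceLeft _))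

/-- The operator-valued function whose values on the line `Re z = 1` are square roots of the
recovered states. -/
noncomputable def recoveryFactor (ρ : Matrix ((a × b) × (c × d)) ((a × b) × (c × d)) ℂ) (z : ℂ) :
    Matrix ((a × b) × (c × d)) ((a × b) × (c × d)) ℂ :=
  ((appendRight (a × b) c d).comp (appendLeft a b c))
      (supportPow (margBC ρ) ((1 / 2 : ℝ) * z)) *
    (((embedLeft (a × b) (c × d)).comp (embedRight a b))
        (supportPow (margB ρ) ((-1 / 2 : ℝ) * z)) *
      (embedLeft (a × b) (c × d) (supportPow (margAB ρ) ((1 / 2 : ℝ) * z)) *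
        (((embedRight (a × b) (c × d)).comp (embedLeft c d))
            (supportPow (margC ρ) ((-1 / 2 : ℝ) * z)) *
          embedRight (a × b) (c × d) (supportPow (margCD ρ) ((1 / 2 : ℝ) * z)))))

theorem isStripFactor_recoveryFactor {ρ : Matrix ((a × b) × (c × d)) ((a × b) × (c × d)) ℂ}
    (hρ : ρ.PosSemidef) :
    IsStripFactor ρ (recoveryFactor ρ)
      (-((entropy (margBC ρ) - entropy (margB ρ) + entropy (margAB ρ) - entropy (margC ρ) +
        entropy (margCD ρ)) / 2 : ℝ)) := by
  have hAB : IsMarginal (embedLeft (a × b) (c × d)) (margAB ρ) ρ := isMarginal_traceRight ρ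
  have hCD : IsMarginal (embedRight (a × b) (c × d)) (margCD ρ) ρ := isMarginal_traceLeft ρ
  have hB : IsMarginal ((embedLeft (a × b) (c × d)).comp (embedRight a b)) (margB ρ) ρ :=
    hAB.comp (isMarginal_traceLeft _)
  have hC : IsMarginal ((embedRight (a × b) (c × d)).comp (embedLeft c d)) (margC ρ) ρ :=
    hCD.comp (isMarginal_traceRight _)
  have pAB : (margAB ρ).PosSemidef := posSemidef_traceRight hρ
  have pCD : (margCD ρ).PosSemidef := posSemidef_traceLeft hρ
  have h1 : |(1 / 2 : ℝ)| ≤ 1 := by norm_num [abs_le]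
  have h2 : |(-1 / 2 : ℝ)| ≤ 1 := by norm_num [abs_le]
  have h := ((isMarginal_margBC ρ).isStripFactor (posSemidef_margBC hρ) hρ _ h1).mul
    ((hB.isStripFactor (posSemidef_traceLeft pAB) hρ _ h2).mul
      ((hAB.isStripFactor pAB hρ _ h1).mul
        ((hC.isStripFactor (posSemidef_traceRight pCD) hρ _ h2).mul
          (hCD.isStripFactor pCD hρ _ h1))))
  convert! h using 1
  push_cast
  ring

theorem recovered_eq {ρ : Matrix ((a × b) × (c × d)) ((a × b) × (c × d)) ℂ}
    (hρ : ρ.PosSemidef) (t : ℝ) :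
    recovered ρ t =
      (recoveryFactor ρ (1 + t * Complex.I))ᴴ * recoveryFactor ρ (1 + t * Complex.I) := by
  have pAB : (margAB ρ).PosSemidef := posSemidef_traceRight hρ
  have pCD : (margCD ρ).PosSemidef := posSemidef_traceLeft hρ
  have pB : (margB ρ).PosSemidef := posSemidef_traceLeft pAB
  have pC : (margC ρ).PosSemidef := posSemidef_traceRight pCD
  have pBC : (margBC ρ).PosSemidef := posSemidef_margBC hρ
  have e1 : ((1 / 2 : ℝ) : ℂ) * (1 + t * Complex.I) = 1 / 2 + Complex.I * t / 2 := by
    push_cast; ring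
  have e2 : ((-1 / 2 : ℝ) : ℂ) * (1 + t * Complex.I) = -1 / 2 - Complex.I * t / 2 := by
    push_cast; ring
  have e3 : star (1 / 2 + Complex.I * t / 2 : ℂ) = 1 / 2 - Complex.I * t / 2 := by
    apply Complex.ext <;> simp [neg_div]
  have e4 : star (-1 / 2 - Complex.I * t / 2 : ℂ) = -1 / 2 + Complex.I * t / 2 := by
    apply Complex.ext <;> simp [neg_div]
  -- Splitting the central ρ_BC into two mutually adjoint powers makes the whole sandwich a product
  -- g†g.
  have hsq : margBC ρ = supportPow (margBC ρ) (1 / 2 - Complex.I * t / 2) *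
      supportPow (margBC ρ) (1 / 2 + Complex.I * t / 2) := by
    rw [supportPow_mul pBC.isHermitian]
    ring_nf
    exact (supportPow_one pBC.isHermitian).symm
  rw [recovered, intermediate, onRight_petzRight, onLeft_petzLeft]
  simp only [map_mul, appendLeft_embedLeft, appendRight_embedLeft, appendRight_embedRight]
  conv_lhs => rw [hsq]
  simp only [recoveryFactor, ← star_eq_conjTranspose, star_mul, ← map_star, e1, e2]
  simp only [star_eq_conjTranspose, supportPow_conjTranspose, pAB, pCD, pB, pC, pBC, e3, e4,
    StarAlgHom.comp_apply, map_mul, Matrix.mul_assoc]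
  rfl

end FourSystemRecovery

end QRecovery

theorem mainTheorem2 {a b c d : Type*} [Fintype a] [DecidableEq a] [Fintype b] [DecidableEq b]
    [Fintype c] [DecidableEq c] [Fintype d] [DecidableEq d]
    (ρ : Matrix ((a × b) × (c × d)) ((a × b) × (c × d)) ℂ) (hρ : QRecovery.IsState ρ) :
    ∃ t : ℝ,
      Real.exp (-(1 / 2) * (QRecovery.cmiACgivenB ρ + QRecovery.cmiBDgivenC ρ +
          QRecovery.cmiADgivenBC ρ)) ≤
        QRecovery.fidelity ρ (QRecovery.recovered ρ t) := by
  obtain ⟨t, ht⟩ := (QRecovery.isStripFactor_recoveryFactor hρ.1).exists_exp_le_fidelity hρ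
  refine ⟨t, ?_⟩
  rw [QRecovery.recovered_eq hρ.1]
  refine le_trans (le_of_eq ?_) ht
  congr 1
  rw [Complex.neg_re, Complex.ofReal_re]
  -- The sum telescopes to S(AB) + S(BC) + S(CD) - S(B) - S(C) - S(ABCD).
  simp only [QRecovery.cmiACgivenB, QRecovery.cmiBDgivenC, QRecovery.cmiADgivenBC]
  ring
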